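/- Let $V$ be a simple vertex operator algebra (VOA) over $\mathbb{C}$, let $G$ be a finite group acting faithfully on $V$ by VOA automorphisms, and let $\mathrm{Irr}(G)$ be the set of irreducible complex characters of $G$. For $\chi\in\mathrm{Irr}(G)$ let $M_\chi$ be the simple $\mathbb{C}G$-module affording $\chi$, and let $V^\chi\subseteq V$ be the $M_\chi$-isotypic component of $V$, that is, the sum of all $\mathbb{C}G$-submodules of $V$ isomorphic to $M_\chi$. Then $V^\chi\neq 0$ for every $\chi\in\mathrm{Irr}(G)$. Here a VOA is a $\mathbb{C}$-vector space $V=\bigoplus_{n\in\mathbb{Z}}V_n$ with $\dim V_n<\infty$ for all $n$ and $V_n=0$ for $n\ll 0$, together with vectors $\mathbf 1\in V_0$, $\omega\in V_2$ and a linear map $v\mapsto Y(v,z)=\sum_{n\in\mathbb{Z}}v_nz^{-n-1}$ from $V$ to $(\mathrm{End}\,V)[[z,z^{-1}]]$ such that $u_nv=0$ for $n$ sufficiently large (depending on $u,v$); $Y(\mathbf 1,z)=1$; $Y(v,z)\mathbf 1\in V[[z]]$ with constant term $v$; the operators $L(n)=\omega_{n+1}$ satisfy the Virasoro relations with some central charge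 $c\in\mathbb{Q}$; $L(0)v=nv$ for $v\in V_n$; $\frac{d}{dz}Y(v,z)=Y(L(-1)v,z)$; and the Jacobi identity holds. It is simple if $V\neq0$ and the only subspaces of $V$ invariant under all $v_n$ ($v\in V$, $n\in\mathbb{Z}$) are $0$ and $V$. An automorphism is an invertible linear map $g:V\to V$ with $gY(v,z)g^{-1}=Y(gv,z)$ for all $v\in V$, $g\mathbf 1=\mathbf 1$ and $g\omega=\omega$. -/

import Mathlib

/-- A vertex operator algebra structure on a complex vector space `V`.
The vertex operator of `u` is `Y u`, with modes `Y(u, z) = ∑ uₙ z⁻ⁿ⁻¹`, where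
`uₙ = VertexOperator.ncoeff (Y u) n`.  Since `Y u` takes values in Laurent series,
`uₙ v = 0` for `n` sufficiently large is part of the type of `Y`. -/
structure VertexOperatorAlgebra (V : Type*) [AddCommGroup V] [Module ℂ V] where
  /-- The homogeneous spaces of the grading. -/
  wt : ℤ → Submodule ℂ V
  isInternal : DirectSum.IsInternal wt
  finite_wt : ∀ n, FiniteDimensional ℂ (wt n)
  wt_eq_bot : ∃ N : ℤ, ∀ n < N, wt n = ⊥
  /-- The state-field correspondence. -/
  Y : V →ₗ[ℂ] VertexOperator ℂ V
  /-- The vacuum vector. -/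
  vac : V
  vac_mem : vac ∈ wt 0
  /-- The Virasoro (conformal) vector. -/
  ω : V
  ω_mem : ω ∈ wt 2
  /-- `Y(𝟏, z) = 1`. -/
  vacuum : ∀ (n : ℤ) (v : V), VertexOperator.ncoeff (Y vac) n v = if n = -1 then v else 0
  /-- `Y(v, z)𝟏` has no negative powers of `z` ... -/
  creation_regular : ∀ (v : V) (n : ℤ), 0 ≤ n → VertexOperator.ncoeff (Y v) n vac = 0
  /-- ... and its value at `z = 0` is `v`. -/
  creation : ∀ v : V, VertexOperator.ncoeff (Y v) (-1) vac = v
  /-- The central charge. -/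
  c : ℚ
  /-- The Virasoro relations for the operators `L(m) = ω_{m+1}`. -/
  virasoro : ∀ m n : ℤ,
    ⁅VertexOperator.ncoeff (Y ω) (m + 1), VertexOperator.ncoeff (Y ω) (n + 1)⁆ =
      ((m : ℂ) - (n : ℂ)) • VertexOperator.ncoeff (Y ω) (m + n + 1) +
        (if m + n = 0 then (((m : ℂ) ^ 3 - (m : ℂ)) / 12 * (c : ℂ)) else 0) •
          (1 : Module.End ℂ V)
  /-- `L(0) v = n v` for `v` in the homogeneous space of weight `n`. -/
  L_zero : ∀ (n : ℤ), ∀ v ∈ wt n, VertexOperator.ncoeff (Y ω) 1 v = (n : ℂ) • v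
  /-- `d/dz Y(v, z) = Y(L(-1) v, z)`, coefficient of `z⁻ⁿ⁻¹`. -/
  L_neg_one : ∀ (v : V) (n : ℤ),
    VertexOperator.ncoeff (Y (VertexOperator.ncoeff (Y ω) 0 v)) n =
      (-(n : ℂ)) • VertexOperator.ncoeff (Y v) (n - 1)
  /-- The Jacobi identity
  `z₀⁻¹ δ((z₁ - z₂)/z₀) Y(u, z₁) Y(v, z₂) - z₀⁻¹ δ((z₂ - z₁)/(-z₀)) Y(v, z₂) Y(u, z₁)
    = z₂⁻¹ δ((z₁ - z₀)/z₂) Y(Y(u, z₀)v, z₂)`,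
  applied to `w`, coefficient of `z₀⁻ˡ⁻¹ z₁⁻ᵐ⁻¹ z₂⁻ⁿ⁻¹`. All three sums have
  finitely many non-zero terms. -/
  jacobi : ∀ (u v w : V) (l m n : ℤ),
    (∑ᶠ i : ℕ, ((-1 : ℤ) ^ i * Ring.choose l i) •
        VertexOperator.ncoeff (Y u) (m + l - i) (VertexOperator.ncoeff (Y v) (n + i) w)) -
      (Int.negOnePow l : ℤ) • (∑ᶠ i : ℕ, ((-1 : ℤ) ^ i * Ring.choose l i) •
        VertexOperator.ncoeff (Y v) (n + l - i) (VertexOperator.ncoeff (Y u) (m + i) w)) =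
    ∑ᶠ i : ℕ, (Ring.choose m i) •
        VertexOperator.ncoeff (Y (VertexOperator.ncoeff (Y u) (l + i) v)) (m + n - i) w

namespace VertexOperatorAlgebra

/-- The mode `uₙ` of the vertex operator `Y(u, z) = ∑ uₙ z⁻ⁿ⁻¹`. -/
noncomputable def mode {V : Type*} [AddCommGroup V] [Module ℂ V]
    (A : VertexOperatorAlgebra V) (u : V) (n : ℤ) : Module.End ℂ V :=
  VertexOperator.ncoeff (A.Y u) n

/-- `V` is simple: it is non-zero, and the only subspaces invariant under all modes `uₙ`
are `0` and `V`. -/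
def IsSimple {V : Type*} [AddCommGroup V] [Module ℂ V] (A : VertexOperatorAlgebra V) : Prop :=
  Nontrivial V ∧ ∀ S : Submodule ℂ V,
    (∀ (u : V) (n : ℤ), ∀ w ∈ S, A.mode u n w ∈ S) → S = ⊥ ∨ S = ⊤

/-- The group of automorphisms of the vertex operator algebra: the invertible linear maps `g`
with `g (uₙ w) = (g u)ₙ (g w)`, i.e. `g Y(u, z) g⁻¹ = Y(g u, z)`, that fix the vacuum and the
Virasoro vector. -/
def automorphismGroup {V : Type*} [AddCommGroup V] [Module ℂ V]
    (A : VertexOperatorAlgebra V) : Subgroup (V ≃ₗ[ℂ] V) where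
  carrier := {g | (∀ (u : V) (n : ℤ) (w : V), g (A.mode u n w) = A.mode (g u) n (g w)) ∧
    g A.vac = A.vac ∧ g A.ω = A.ω}
  one_mem' := ⟨fun _ _ _ => rfl, rfl, rfl⟩
  mul_mem' := by
    rintro g h ⟨hg, hg1, hg2⟩ ⟨hh, hh1, hh2⟩
    refine ⟨fun u n w => ?_, ?_, ?_⟩
    · simp only [LinearEquiv.mul_apply, hh, hg]
    · simp only [LinearEquiv.mul_apply, hh1, hg1]
    · simp only [LinearEquiv.mul_apply, hh2, hg2]
  inv_mem' := by
    rintro g ⟨hg, hg1, hg2⟩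
    have h (x : V) : g (g⁻¹ x) = x := g.apply_symm_apply x
    refine ⟨fun u n w => g.injective ?_, g.injective ?_, g.injective ?_⟩
    · rw [hg, h, h, h]
    · rw [h, hg1]
    · rw [h, hg2]

/-- The representation of `G` on `V` given by an action of `G` by automorphisms. -/
def representation {V : Type*} [AddCommGroup V] [Module ℂ V] (A : VertexOperatorAlgebra V)
    {G : Type*} [Group G] (ρ : G →* A.automorphismGroup) : Representation ℂ G V :=
  (LinearEquiv.automorphismGroup.toLinearMapMonoidHom (R := ℂ) (M := V)).comp
    (A.automorphismGroup.subtype.comp ρ)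

/-- For the irreducible representation `σ` of `G` affording the character `χ`, this is `V^χ`:
the sum of all `ℂ[G]`-submodules of `V` isomorphic to `σ`. -/
noncomputable def isotypicPart {V : Type*} [AddCommGroup V] [Module ℂ V]
    (A : VertexOperatorAlgebra V) {G : Type*} [Group G] (ρ : G →* A.automorphismGroup)
    {M : Type*} [AddCommGroup M] [Module ℂ M] (σ : Representation ℂ G M) :
    Submodule (MonoidAlgebra ℂ G) (A.representation ρ).asModule :=
  isotypicComponent (MonoidAlgebra ℂ G) (A.representation ρ).asModule σ.asModule

end VertexOperatorAlgebra

/-!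
The proof is a version of Dedekind's independence of characters: distinct automorphisms of a
simple vertex operator algebra `V` are linearly independent in `End V`
(`VertexOperatorAlgebra.IsSimple.linearIndependent_automorphism`). Hence the semisimple algebra `ℂ[G]` acts
faithfully on `V`. Every simple `ℂ[G]`-module is isomorphic to a minimal left ideal of `ℂ[G]`, and
`a ↦ a v` embeds this ideal into `V` for any `v` it does not annihilate.

For the independence, let `T` be a linearly independent finite set of automorphisms and suppose
`h = ∑_{g ∈ T} a_g g` with `h ∉ T`. Evaluating this at `uₙ v` in two ways gives
`∑_{g ∈ T} Y(a_g (g u - h u), z) g v = 0` for all `u`, `v`. Three facts turn this into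
`a_g (g u - h u) = 0` for all `g ∈ T`:

* For fixed vectors `y_g`, the tuples `x ∈ V^T` with `∑_g Y(y_g, z) x_g = 0` form a submodule of
  `V^T` over the algebra generated by all modes (`mode_sum_comp_eq_zero`). This is the usual
  commutativity `(z₁ - z₂)^N [Y(u, z₁), Y(w, z₂)] = 0` of vertex operators.
* A proper submodule of `V^T` satisfies a nontrivial linear relation
  `∑_g c_g x_g = 0` (`exists_linear_relation`), because `V` is a simple module over the mode
  algebra, whose endomorphisms of `V` are the scalars: they commute with `L(0)`, so they have an
  eigenvector in a weight space. Since `T` is linearly independent, the submodule generated by the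
  tuples `(g v)_g` is therefore all of `V^T`.
* If `Y(y, z) 𝟏 = 0`, then `y = 0`, by the creation property.

As `h` is different from each `g ∈ T`, all `a_g` vanish, so `h = 0`, which is absurd.
-/

open Finset

/-! ### Submodules of powers of a simple module -/

/-- If all endomorphisms of a simple `R`-module `V` are scalars from `K`, then a proper
submodule of `ι → V` satisfies a nontrivial linear relation with coefficients in `K`. -/
theorem exists_linear_relation {K R V ι : Type*} [Field K] [Ring R] [AddCommGroup V] [Module K V]
    [Module R V] [IsSimpleModule R V] [Fintype ι]
    (schur : ∀ f : V →ₗ[R] V, ∃ c : K, ∀ v, f v = c • v)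
    (W : Submodule R (ι → V)) (hW : W ≠ ⊤) :
    ∃ c : ι → K, c ≠ 0 ∧ ∀ x ∈ W, ∑ i, c i • x i = 0 := by
  classical
  obtain ⟨C, hC⟩ := exists_isCompl W
  -- the projection onto a complement of `W` vanishes on `W`; its components are matrices of scalars
  let p : (ι → V) →ₗ[R] (ι → V) := C.subtype ∘ₗ C.projectionOnto W hC.symm
  have hp : p ≠ 0 := by
    intro h
    apply hW
    rw [eq_top_iff]
    intro x _
    have h1 : p x = 0 := by rw [h]; rfl
    have h2 : C.projectionOnto W hC.symm x = 0 := Subtype.ext h1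
    simpa using h2
  obtain ⟨j, hj⟩ : ∃ j, LinearMap.proj j ∘ₗ p ≠ 0 := by
    by_contra! h
    exact hp (LinearMap.ext fun x => funext fun j => LinearMap.congr_fun (h j) x)
  choose c hc using fun i =>
    schur (LinearMap.proj j ∘ₗ p ∘ₗ LinearMap.single R (fun _ : ι => V) i)
  have hsum (x : ι → V) : p x j = ∑ i, c i • x i := by
    conv_lhs => rw [← Finset.univ_sum_single x]
    simp only [map_sum, Finset.sum_apply]
    exact Finset.sum_congr rfl fun i _ => hc i (x i)
  refine ⟨c, ?_, ?_⟩
  · rintro rfl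
    exact hj (LinearMap.ext fun x => by simpa using hsum x)
  · intro x hx
    rw [← hsum]
    have : C.projectionOnto W hC.symm x = 0 := by simpa using hx
    simp [p, this]

/-! ### Embedding simple modules into a faithful module -/

/-- Over a semisimple ring, a faithful module has a nonzero isotypic component for every simple
module. -/
theorem isotypicComponent_ne_bot_of_faithful {R M S : Type*} [Ring R] [IsSemisimpleRing R]
    [AddCommGroup M] [Module R M] [FaithfulSMul R M] [AddCommGroup S] [Module R S]
    [IsSimpleModule R S] : isotypicComponent R M S ≠ ⊥ := by
  obtain ⟨I, ⟨e⟩⟩ := IsSemisimpleRing.exists_linearEquiv_ideal_of_isSimpleModule R S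
  have : IsSimpleModule R I := .congr e.symm
  have := IsSimpleModule.nontrivial R I
  obtain ⟨r, hr⟩ := exists_ne (0 : I)
  obtain ⟨v, hv⟩ : ∃ v : M, (r : R) • v ≠ 0 := by
    by_contra! h
    exact hr (Subtype.ext (FaithfulSMul.eq_of_smul_eq_smul (α := M) fun v => by simp [h v]))
  let f : I →ₗ[R] M := LinearMap.toSpanSingleton R M v ∘ₗ I.subtype
  have hf : Function.Injective f :=
    f.injective_or_eq_zero.resolve_right fun h => hv (LinearMap.congr_fun h r)
  have hle : LinearMap.range f ≤ isotypicComponent R M S :=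
    le_sSup ⟨(LinearEquiv.ofInjective f hf).symm.trans e.symm⟩
  intro h
  rw [h, le_bot_iff] at hle
  exact hv ((Submodule.mem_bot R).mp (hle ▸ LinearMap.mem_range_self f r))

namespace VertexOperatorAlgebra

variable {V : Type*} [AddCommGroup V] [Module ℂ V] (A : VertexOperatorAlgebra V)

/-! ### Commutativity of vertex operators -/

/-- Truncation: `u_n v = 0` for large `n`, by the definition of Laurent series. -/
theorem exists_forall_mode_eq_zero (u v : V) : ∃ N : ℕ, ∀ n : ℤ, N ≤ n → A.mode u n v = 0 := by
  refine ⟨(-((HahnModule.of ℂ).symm (A.Y u v)).order).toNat, fun n hn => ?_⟩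
  exact VertexOperator.ncoeff_eq_zero_of_lt_order _ _ _ (by lia)

/-- A bound for truncation that is uniform over a finite family of pairs. -/
theorem exists_forall_mode_family_eq_zero {ι : Type*} [Finite ι] (u v : ι → V) :
    ∃ N : ℕ, ∀ i, ∀ n : ℤ, N ≤ n → A.mode (u i) n (v i) = 0 := by
  have := Fintype.ofFinite ι
  choose N hN using fun i => A.exists_forall_mode_eq_zero (u i) (v i)
  refine ⟨∑ i, N i, fun i n hn => hN i n (le_trans ?_ hn)⟩
  exact_mod_cast Finset.single_le_sum (f := N) (fun _ _ => Nat.zero_le _) (Finset.mem_univ i)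

/-- The coefficients of `(z₁ - z₂)^l [Y(u, z₁), Y(v, z₂)] w = 0`, for `l` so large that
`u_k v = 0` for all `k ≥ l`. -/
theorem locality (u v w : V) (l : ℕ) (hl : ∀ n : ℤ, l ≤ n → A.mode u n v = 0) (m n : ℤ) :
    ∑ i ∈ range (l + 1), ((-1 : ℤ) ^ i * (l.choose i : ℤ)) •
        A.mode u (m + l - i) (A.mode v (n + i) w) =
      (Int.negOnePow l : ℤ) • ∑ i ∈ range (l + 1), ((-1 : ℤ) ^ i * (l.choose i : ℤ)) •
        A.mode v (n + l - i) (A.mode u (m + i) w) := by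
  have hfin (F : ℕ → V) : ∑ᶠ i : ℕ, ((-1 : ℤ) ^ i * Ring.choose (l : ℤ) i) • F i =
      ∑ i ∈ range (l + 1), ((-1 : ℤ) ^ i * (l.choose i : ℤ)) • F i := by
    simp only [Ring.choose_natCast]
    refine finsum_eq_sum_of_support_subset _ fun i hi => ?_
    by_contra h
    refine hi ?_
    have : l < i := by simpa [Nat.lt_succ_iff] using h
    simp [Nat.choose_eq_zero_of_lt this]
  have h := A.jacobi u v w l m n
  rw [hfin, hfin] at h
  rw [← sub_eq_zero]
  refine h.trans (finsum_eq_zero_of_forall_eq_zero fun i => ?_)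
  have : VertexOperator.ncoeff (A.Y u) (l + i) v = 0 := hl _ (by lia)
  simp [this]

/-- If `∑ᵢ Y(yᵢ, z) xᵢ = 0`, then `∑ᵢ Y(yᵢ, z) w_q xᵢ = 0` for every mode `w_q`. -/
theorem mode_sum_comp_eq_zero {ι : Type*} [Fintype ι] (y x : ι → V)
    (hx : ∀ n : ℤ, ∑ i, A.mode (y i) n (x i) = 0) (w : V) (p q : ℤ) :
    ∑ i, A.mode (y i) p (A.mode w q (x i)) = 0 := by
  obtain ⟨l, hl⟩ := A.exists_forall_mode_family_eq_zero y fun _ => w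
  obtain ⟨Q, hQ⟩ := A.exists_forall_mode_family_eq_zero (fun _ : ι => w) x
  have key (m n : ℤ) : ∑ k ∈ range (l + 1), ((-1 : ℤ) ^ k * (l.choose k : ℤ)) •
      ∑ i, A.mode (y i) (m + l - k) (A.mode w (n + k) (x i)) = 0 := by
    simp only [Finset.smul_sum]
    rw [Finset.sum_comm]
    simp only [fun i => A.locality (y i) w (x i) l (hl i) m n, ← Finset.smul_sum]
    rw [Finset.sum_comm]
    simp only [← Finset.smul_sum, ← map_sum, hx, map_zero, smul_zero, Finset.sum_const_zero]
  -- downward induction on `q`, starting at `q ≥ Q`, where `w_q xᵢ = 0` for all `i`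
  suffices h : ∀ (d : ℕ) (p q : ℤ), (Q : ℤ) - d ≤ q →
      ∑ i, A.mode (y i) p (A.mode w q (x i)) = 0 from h (Q - q).toNat p q (by lia)
  intro d
  induction d with
  | zero =>
    intro p q hq
    exact Finset.sum_eq_zero fun i _ => by rw [hQ i q (by lia), map_zero]
  | succ d ih =>
    intro p q hq
    have h := key (p - l) q
    rw [Finset.sum_range_succ', Finset.sum_eq_zero fun k _ => by
      rw [ih _ _ (by push_cast at hq ⊢; lia), smul_zero]] at h
    simpa using h

/-! ### The algebra generated by the modes -/

/-- The associative subalgebra of `End V` generated by all modes of vertex operators. -/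
def modeAlgebra : Subalgebra ℂ (Module.End ℂ V) :=
  Algebra.adjoin ℂ {a | ∃ u n, a = A.mode u n}

theorem mode_mem_modeAlgebra (u : V) (n : ℤ) : A.mode u n ∈ A.modeAlgebra :=
  Algebra.subset_adjoin ⟨u, n, rfl⟩

variable {A}

theorem IsSimple.isSimpleModule (hA : A.IsSimple) : IsSimpleModule A.modeAlgebra V := by
  have := hA.1
  refine { eq_bot_or_eq_top := fun S => ?_ }
  have h := hA.2 (S.restrictScalars ℂ) fun u n w hw =>
    S.smul_mem ⟨A.mode u n, A.mode_mem_modeAlgebra u n⟩ hw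
  simpa using h

theorem exists_wt_ne_bot [Nontrivial V] : ∃ n, A.wt n ≠ ⊥ := by
  by_contra! h
  have h1 := A.isInternal.submodule_iSup_eq_top
  rw [iSup_congr h, iSup_bot] at h1
  exact bot_ne_top h1

/-- The weight spaces are the full eigenspaces of `L(0)`: they exhaust `V`, and the eigenspaces
containing them are independent. -/
theorem mem_wt_of_L_zero {n : ℤ} {v : V} (hv : A.mode A.ω 1 v = (n : ℂ) • v) : v ∈ A.wt n := by
  let E : ℤ → Submodule ℂ V := fun k => (A.mode A.ω 1).eigenspace (k : ℂ)
  have hE : iSupIndep E :=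
    (Module.End.eigenspaces_iSupIndep (A.mode A.ω 1)).comp Int.cast_injective
  have hle (k : ℤ) : A.wt k ≤ E k := fun x hx => Module.End.mem_eigenspace_iff.mpr (A.L_zero k x hx)
  have htop : A.wt n ⊔ ⨆ (k) (_ : k ≠ n), A.wt k = ⊤ := by
    rw [eq_top_iff, ← A.isInternal.submodule_iSup_eq_top]
    refine iSup_le fun k => ?_
    obtain rfl | hk := eq_or_ne k n
    · exact le_sup_left
    · exact le_sup_of_le_right (le_iSup₂_of_le k hk le_rfl)
  obtain ⟨a, ha, b, hb, rfl⟩ := Submodule.mem_sup.mp (htop ▸ Submodule.mem_top : v ∈ _)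
  have hab : a + b ∈ E n := Module.End.mem_eigenspace_iff.mpr hv
  have hbn : b ∈ E n := by simpa using (E n).sub_mem hab (hle n ha)
  have hb0 : b = 0 := Submodule.disjoint_def.mp (hE n) b hbn
    (iSup₂_mono (fun k _ => hle k) hb)
  simpa [hb0] using ha

/-- Schur's lemma: an endomorphism commuting with all modes is a scalar, because it has an
eigenvector in each nonzero weight space. -/
theorem IsSimple.exists_eq_smul (hA : A.IsSimple) (f : V →ₗ[A.modeAlgebra] V) :
    ∃ c : ℂ, ∀ v, f v = c • v := by
  have := hA.1
  have := hA.isSimpleModule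
  obtain ⟨n, hn⟩ := A.exists_wt_ne_bot
  have hcomm (u : V) (k : ℤ) (v : V) : f (A.mode u k v) = A.mode u k (f v) :=
    f.map_smul ⟨A.mode u k, A.mode_mem_modeAlgebra u k⟩ v
  let F : V →ₗ[ℂ] V := f.restrictScalars ℂ
  have hF : ∀ v ∈ A.wt n, F v ∈ A.wt n := fun v hv => mem_wt_of_L_zero <| by
    change A.mode A.ω 1 (f v) = (n : ℂ) • F v
    rw [← hcomm, ← map_smul F]
    exact congrArg f (A.L_zero n v hv)
  have := A.finite_wt n
  have := (Submodule.nontrivial_iff_ne_bot).mpr hn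
  obtain ⟨c, hc⟩ := Module.End.exists_eigenvalue (F.restrict hF)
  obtain ⟨x, hx⟩ := hc.exists_hasEigenvector
  have hx1 : F x = c • (x : V) := congrArg Subtype.val hx.apply_eq_smul
  have hx2 : (x : V) ≠ 0 := fun h => hx.2 (Subtype.ext h)
  refine ⟨c, fun v => ?_⟩
  have h := (hA.2 (LinearMap.ker (F - c • LinearMap.id)) fun u k w hw => ?_).resolve_left ?_
  · have : v ∈ LinearMap.ker (F - c • LinearMap.id) := h ▸ Submodule.mem_top
    simpa [sub_eq_zero, F] using this
  · have hw' : f w = c • w := by simpa [sub_eq_zero, F] using hw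
    simp [F, hcomm, hw']
  · intro h
    refine hx2 ((Submodule.mem_bot ℂ).mp (h ▸ ?_))
    simp [hx1]

/-! ### Linear independence of automorphisms -/

/-- If finitely many operators `gᵢ` are linearly independent, then the tuples `(gᵢ v)ᵢ` generate
`V^ι`, so that `∑ᵢ Y(yᵢ, z) gᵢ v = 0` for all `v` forces every `yᵢ` to vanish. -/
theorem IsSimple.eq_zero_of_forall_sum_mode_eq_zero (hA : A.IsSimple) {ι : Type*} [Fintype ι]
    {g : ι → Module.End ℂ V} (hg : LinearIndependent ℂ g) (y : ι → V)
    (hy : ∀ (v : V) (n : ℤ), ∑ i, A.mode (y i) n (g i v) = 0) (i : ι) : y i = 0 := by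
  classical
  have := hA.isSimpleModule
  let K : Submodule A.modeAlgebra (ι → V) :=
    { carrier := {x | ∀ n : ℤ, ∑ i, A.mode (y i) n (x i) = 0}
      add_mem' := fun hx hx' n => by
        simp [Finset.sum_add_distrib, hx n, hx' n]
      zero_mem' := fun n => by simp
      smul_mem' := by
        rintro ⟨a, ha⟩ x hx
        change ∀ n : ℤ, ∑ i, A.mode (y i) n (a (x i)) = 0
        replace hx : ∀ n : ℤ, ∑ i, A.mode (y i) n (x i) = 0 := hx
        induction ha using Algebra.adjoin_induction generalizing x with
        | mem a ha =>
          obtain ⟨w, q, rfl⟩ := ha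
          exact fun n => A.mode_sum_comp_eq_zero y x hx w n q
        | algebraMap c =>
          intro n
          simp [Module.algebraMap_end_apply, ← Finset.smul_sum, hx n]
        | add a b _ _ iha ihb =>
          intro n
          simp [Finset.sum_add_distrib, iha hx n, ihb hx n]
        | mul a b _ _ iha ihb => exact iha (x := fun i => b (x i)) (ihb hx) }
  have hK : K = ⊤ := by
    by_contra h
    obtain ⟨c, hc0, hc⟩ := exists_linear_relation (K := ℂ) hA.exists_eq_smul K h
    refine hc0 (funext (Fintype.linearIndependent_iff.mp hg c (LinearMap.ext fun v => ?_)))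
    simpa using hc (fun i => g i v) (hy v)
  have h : Pi.single i A.vac ∈ K := hK ▸ Submodule.mem_top
  have h1 := h (-1)
  rw [Finset.sum_eq_single i (fun j _ hj => by simp [hj]) (by simp), Pi.single_eq_same] at h1
  exact (A.creation (y i)).symm.trans h1

/-- The linear operator underlying an automorphism. -/
def automorphismToEnd (g : A.automorphismGroup) : Module.End ℂ V := (g : V ≃ₗ[ℂ] V).toLinearMap

theorem automorphismToEnd_mode (g : A.automorphismGroup) (u : V) (n : ℤ) (v : V) :
    automorphismToEnd g (A.mode u n v) =
      A.mode (automorphismToEnd g u) n (automorphismToEnd g v) :=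
  g.2.1 u n v

theorem automorphismToEnd_injective :
    Function.Injective (automorphismToEnd : A.automorphismGroup → Module.End ℂ V) :=
  fun _ _ h => Subtype.ext (LinearEquiv.toLinearMap_injective h)

/-- Distinct automorphisms of a simple vertex operator algebra are linearly independent. -/
theorem IsSimple.linearIndependent_automorphism (hA : A.IsSimple) :
    LinearIndependent ℂ (automorphismToEnd : A.automorphismGroup → Module.End ℂ V) := by
  classical
  have := hA.1
  rw [linearIndependent_iff_finset_linearIndependent]
  intro T
  change LinearIndepOn ℂ _ (T : Set A.automorphismGroup)
  induction T using Finset.induction_on with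
  | empty => simp
  | insert h T hT ih =>
    rw [Finset.coe_insert, linearIndepOn_insert (by simpa using hT)]
    refine ⟨ih, fun hmem => ?_⟩
    obtain ⟨a, ha⟩ := (Submodule.mem_span_image_finset_iff_exists_fun ℂ).mp hmem
    have hexp (v : V) : automorphismToEnd h v = ∑ g : T, a g • automorphismToEnd g.1 v := by
      simp [← ha]
    have hzero (u : V) (g : T) :
        a g • (automorphismToEnd g.1 u - automorphismToEnd h u) = 0 := by
      refine hA.eq_zero_of_forall_sum_mode_eq_zero ih
        (fun g : T => a g • (automorphismToEnd g.1 u - automorphismToEnd h u)) (fun v n => ?_) g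
      have h1 := hexp (A.mode u n v)
      rw [automorphismToEnd_mode, hexp v, map_sum] at h1
      simp only [automorphismToEnd_mode, map_smul] at h1
      have hmode (c : ℂ) (x y z : V) :
          A.mode (c • (x - y)) n z = c • A.mode x n z - c • A.mode y n z := by
        simp [mode, smul_sub]
      simp only [hmode, Finset.sum_sub_distrib]
      exact sub_eq_zero.mpr h1.symm
    have ha0 (g : T) : a g = 0 := by
      by_contra hg
      refine hT ?_
      have : g.1 = h := automorphismToEnd_injective <| LinearMap.ext fun u =>
        sub_eq_zero.mp ((smul_eq_zero.mp (hzero u g)).resolve_left hg)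
      exact this ▸ g.2
    obtain ⟨v, hv⟩ := exists_ne (0 : V)
    refine hv ((h : V ≃ₗ[ℂ] V).map_eq_zero_iff.mp ?_)
    exact (hexp v).trans (by simp [ha0])

end VertexOperatorAlgebra

theorem theorem2 {V : Type*} [AddCommGroup V] [Module ℂ V] (A : VertexOperatorAlgebra V)
    (hA : A.IsSimple) {G : Type*} [Group G] [Finite G] (ρ : G →* A.automorphismGroup)
    (hρ : Function.Injective ρ) {M : Type*} [AddCommGroup M] [Module ℂ M]
    (σ : Representation ℂ G M) (hσ : σ.IsIrreducible) :
    A.isotypicPart ρ σ ≠ ⊥ := by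
  have := (Representation.irreducible_iff_isSimpleModule_asModule σ).mp hσ
  have : NeZero (Nat.card G : ℂ) := ⟨Nat.cast_ne_zero.mpr Nat.card_pos.ne'⟩
  have hind := hA.linearIndependent_automorphism.comp ρ hρ
  have hfaith : FaithfulSMul (MonoidAlgebra ℂ G) (A.representation ρ).asModule := by
    refine ⟨fun {a b} hab => ?_⟩
    have h : (A.representation ρ).asAlgebraHom a = (A.representation ρ).asAlgebraHom b :=
      LinearMap.ext hab
    rw [Representation.asAlgebraHom_def, MonoidAlgebra.lift_apply, MonoidAlgebra.lift_apply] at h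
    exact MonoidAlgebra.coeff_injective (hind h)
  exact isotypicComponent_ne_bot_of_faithful
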